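/- Let $\mathbb{D}=\{|z|<1\}$ and $\mathbb{T}=\{|z|=1\}$, and let $\mathcal{D}_a$ be the space of functions that are analytic on $\mathbb{D}$ and smooth on $\overline{\mathbb{D}}$. Let $\lambda$ denote arc length and $A$ area. For $f\in\mathcal{D}_a$ and $k\in\mathbb{Z}$ put $\hat f(k)=\frac1{2\pi}\int_{\mathbb{T}}f(\zeta)\overline{\zeta}^{k}\,d\lambda(\zeta)$ (so $\hat f(-1)=0$). For a finite positive Borel measure $\mu$ on $\mathbb{T}$ let $P_\mu(z)=\int_{\mathbb{T}}\frac{1-|z|^2}{|\zeta-z|^2}\,d\mu(\zeta)$, $z\in\mathbb{D}$, and for $f\in\mathcal{D}_a$ define $$\mathcal{D}_{\mu,0}(f)=\lim_{r\to1^-}\frac1{2\pi r}\int_{r\mathbb{T}}|f|^2P_\mu\,d\lambda,\qquad \mathcal{D}_{\mu,n}(f)=\lim_{r\to1^-}\frac1{n!(n-1)!\,\pi}\int_{r\mathbb{D}}|f^{(n)}(z)|^2P_\mu(z)(1-|z|^2)^{n-1}\,dA(z)\quad(n\ge1).$$ **Proposition 4.6.** Let $\mu$ be a finite positive Borel measure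 on $\mathbb{T}$ and let $n\ge0$ be an integer. Then the limits defining $\mathcal{D}_{\mu,n}(f)$ exist and are finite for all $f\in\mathcal{D}_a$, and there is a constant $C\in(0,\infty)$, depending only on $\mu$ and $n$, such that $$\mathcal{D}_{\mu,n}(f)\le\mathcal{D}_{\mu,n}(zf)\le C\left(|\hat f(n-1)|^2+\mathcal{D}_{\mu,n}(f)\right)\qquad\text{for all }f\in\mathcal{D}_a.$$ -/

import Mathlib

open MeasureTheory Filter Topology
open scoped ContDiff ComplexConjugate

noncomputable section

namespace DirichletInt

/-- The space of functions that are analytic on the open unit disc and smooth on its closure.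
Values of `f` off the closed unit disc play no role anywhere below. -/
def SmoothAnalytic : Set (ℂ → ℂ) :=
  {f | DifferentiableOn ℂ f (Metric.ball 0 1) ∧ ContDiffOn ℝ ∞ f (Metric.closedBall 0 1)}

/-- The operator `M_z`, multiplication by the independent variable. -/
def mulZ (f : ℂ → ℂ) : ℂ → ℂ := fun z => z * f z

theorem mulZ_mem {f : ℂ → ℂ} (hf : f ∈ SmoothAnalytic) : mulZ f ∈ SmoothAnalytic :=
  ⟨differentiableOn_id.mul hf.1, contDiffOn_id.mul hf.2⟩

/-- The Fourier coefficient `(1 / 2π) ∫_𝕋 f(ζ) (conj ζ) ^ k dλ(ζ)`, with `λ` arc length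
and `k` any integer. -/
def fourierCoef (f : ℂ → ℂ) (k : ℤ) : ℂ :=
  Real.circleAverage (fun ζ => f ζ * conj ζ ^ k) 0 1

/-- The Poisson extension `P_μ(z) = ∫_𝕋 (1 - |z|²) / |ζ - z|² dμ(ζ)`, for `|z| < 1`. -/
def poissonExt (μ : Measure (Metric.sphere (0 : ℂ) 1)) (z : ℂ) : ℝ :=
  ∫ ζ : Metric.sphere (0 : ℂ) 1, (1 - ‖z‖ ^ 2) / ‖(ζ : ℂ) - z‖ ^ 2 ∂μ

/-- The truncation at radius `r` of the weighted Dirichlet integral of order `n`. For `n = 0` it is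
`(1 / 2πr) ∫_{r𝕋} |f|² P_μ dλ`, the mean over the circle of radius `r`; for `n ≥ 1` it is
`(1 / (n! (n-1)! π)) ∫_{r𝔻} |f⁽ⁿ⁾(z)|² P_μ(z) (1 - |z|²)ⁿ⁻¹ dA(z)`. -/
def truncated (μ : Measure (Metric.sphere (0 : ℂ) 1)) : ℕ → (ℂ → ℂ) → ℝ → ℝ
  | 0, f, r => Real.circleAverage (fun ζ => ‖f ζ‖ ^ 2 * poissonExt μ ζ) 0 r
  | n + 1, f, r => 1 / ((n + 1).factorial * n.factorial * Real.pi) *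
      ∫ z in Metric.ball (0 : ℂ) r,
        ‖iteratedDeriv (n + 1) f z‖ ^ 2 * poissonExt μ z * (1 - ‖z‖ ^ 2) ^ n

/-- The weighted Dirichlet integral of order `n`: the limit of the truncations as `r → 1⁻`. -/
def dirichlet (μ : Measure (Metric.sphere (0 : ℂ) 1)) (n : ℕ) (f : ℂ → ℂ) : ℝ :=
  limUnder (𝓝[<] (1 : ℝ)) (truncated μ n f)

end DirichletInt

end

/-! For order `n + 1` everything reduces to one boundary point `w`. By Tonelli the Dirichlet
integral is the `μ`-integral of local integrals weighted by the Poisson kernel at `w`, and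
`lintegral_local` computes these from the Taylor coefficients `a_k`. Absorbing `1 / |w - z|²` into
the function divides `f⁽ⁿ⁺¹⁾` by `w - z` and leaves a radial weight, for which monomials are
orthogonal; the summation by parts in `hasSum_norm_sq_weighted_difference` then yields `∑ C(k+n, n)
|t_{k+n+1}|²`. Here `t_k = ∑_j a_{k+j} w^j`, and `t_{k+1}` is the `k`-th coefficient of `(f(z) -
f(w)) / (z - w)`.

In this form multiplication by `z` merely shifts the tails `t_k`. The bounds `C(k+n, n) ≤ C(k+n+1,
n) ≤ (n+1) C(k+n, n)` compare all terms except a new one, `|t_n|²`. It is nonnegative, which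
suffices for the lower bound; for the upper bound, `t_n = a_n + w t_{n+1}` brings in the Fourier
coefficient of the statement. Integrating over `μ` finishes the proof.

For order `0` the circle means are Abel means of squared partial sums on the boundary, so the limit
is `∫ |f|² dμ`, which multiplication by `z` preserves. -/

noncomputable section

namespace DirichletInt

/-! ### Fourier coefficients and Parseval on the unit circle -/

open Real in
theorem circleAverage_pow_mul_conj_pow (k m : ℕ) :
    circleAverage (fun ζ : ℂ => ζ ^ k * conj ζ ^ m) 0 1 = if k = m then 1 else 0 := by
  have h1 : circleAverage (fun ζ : ℂ => ζ ^ k * conj ζ ^ m) 0 1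
      = circleAverage (fun ζ : ℂ => ζ ^ ((k : ℤ) - m)) 0 1 := by
    apply circleAverage_congr_sphere
    intro ζ hζ
    have hn : ‖ζ‖ = 1 := by simpa using hζ
    have h0 : ζ ≠ 0 := by rintro rfl; simp at hn
    have : conj ζ = ζ⁻¹ := by rw [Complex.inv_eq_conj hn]
    simp only [this]
    rw [zpow_sub₀ h0, zpow_natCast, zpow_natCast, inv_pow]
    rfl
  rw [h1]
  split_ifs with h
  · subst h
    simp [circleAverage_const]
  · rw [circleAverage_eq_circleIntegral one_ne_zero]
    have : (∮ z in C(0, 1), (z - 0)⁻¹ • z ^ ((k : ℤ) - m))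
        = ∮ z in C(0, 1), (z - 0) ^ ((k : ℤ) - m - 1) := by
      apply circleIntegral.integral_congr zero_le_one
      intro ζ hζ
      have hn : ‖ζ‖ = 1 := by simpa using hζ
      have h0 : ζ ≠ 0 := by rintro rfl; simp at hn
      simp only [sub_zero, smul_eq_mul]
      rw [zpow_sub_one₀ h0, mul_comm]
    rw [this, circleIntegral.integral_sub_zpow_of_ne (by omega), smul_zero]

theorem hasSum_circleAverage {F : ℕ → ℂ → ℂ} {f : ℂ → ℂ} {B : ℕ → ℝ} (hB : Summable B)
    (hF : ∀ k, Measurable (F k))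
    (hFB : ∀ k, ∀ ζ ∈ Metric.sphere (0 : ℂ) 1, ‖F k ζ‖ ≤ B k)
    (hs : ∀ ζ ∈ Metric.sphere (0 : ℂ) 1, HasSum (fun k => F k ζ) (f ζ)) :
    HasSum (fun k => Real.circleAverage (F k) 0 1) (Real.circleAverage f 0 1) := by
  have hmem : ∀ θ : ℝ, circleMap 0 1 θ ∈ Metric.sphere (0 : ℂ) 1 :=
    fun θ => circleMap_mem_sphere 0 zero_le_one θ
  simp only [Real.circleAverage_def]
  apply HasSum.const_smul
  apply intervalIntegral.hasSum_integral_of_dominated_convergence (fun k _ => B k)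
  · intro k
    exact ((hF k).comp (by fun_prop)).aestronglyMeasurable
  · exact fun k => Eventually.of_forall fun θ _ => hFB k _ (hmem θ)
  · exact Eventually.of_forall fun θ _ => hB
  · simp
  · exact Eventually.of_forall fun θ _ => hs _ (hmem θ)

theorem circleAverage_mul_conj_pow {a : ℕ → ℂ} {f : ℂ → ℂ} (ha : Summable fun k => ‖a k‖)
    (hf : ∀ ζ ∈ Metric.sphere (0 : ℂ) 1, HasSum (fun k => a k * ζ ^ k) (f ζ)) (m : ℕ) :
    Real.circleAverage (fun ζ => f ζ * conj ζ ^ m) 0 1 = a m := by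
  have h := hasSum_circleAverage (F := fun k ζ => a k * (ζ ^ k * conj ζ ^ m))
    (f := fun ζ => f ζ * conj ζ ^ m) ha (fun k => by fun_prop)
    (fun k ζ hζ => by
      have : ‖ζ‖ = 1 := by simpa using hζ
      simp [this])
    (fun ζ hζ => by simpa [mul_assoc] using (hf ζ hζ).mul_right (conj ζ ^ m))
  refine h.unique ?_
  have : ∀ k, Real.circleAverage (fun ζ : ℂ => a k * (ζ ^ k * conj ζ ^ m)) 0 1
      = if k = m then a m else 0 := by
    intro k
    have := Real.circleAverage_fun_smul (a := a k) (f := fun ζ : ℂ => ζ ^ k * conj ζ ^ m)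
      (c := 0) (R := 1)
    simp only [smul_eq_mul] at this
    rw [this, circleAverage_pow_mul_conj_pow]
    split_ifs with h <;> simp [h]
  simp only [this]
  exact hasSum_ite_eq m (a m)

theorem circleAverage_ofReal (f : ℂ → ℝ) (c : ℂ) (R : ℝ) :
    Real.circleAverage (fun ζ => (f ζ : ℂ)) c R = ((Real.circleAverage f c R : ℝ) : ℂ) := by
  simp only [Real.circleAverage_def, intervalIntegral.integral_ofReal]
  simp

/-- Parseval's identity for an absolutely convergent power series on the unit circle. -/
theorem hasSum_norm_sq_circleAverage {a : ℕ → ℂ} {f : ℂ → ℂ} (hm : Measurable f)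
    (ha : Summable fun k => ‖a k‖)
    (hf : ∀ ζ ∈ Metric.sphere (0 : ℂ) 1, HasSum (fun k => a k * ζ ^ k) (f ζ)) :
    HasSum (fun k => ‖a k‖ ^ 2) (Real.circleAverage (fun ζ => ‖f ζ‖ ^ 2) 0 1) := by
  have hb : ∀ ζ ∈ Metric.sphere (0 : ℂ) 1, ‖f ζ‖ ≤ ∑' k, ‖a k‖ := by
    intro ζ hζ
    rw [← (hf ζ hζ).tsum_eq]
    have h1 : ‖ζ‖ = 1 := by simpa using hζ
    refine (norm_tsum_le_tsum_norm ?_).trans_eq ?_ <;> simp [h1, ha]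
  have h := hasSum_circleAverage (F := fun k ζ => conj (a k) * (f ζ * conj ζ ^ k))
    (f := fun ζ => ((‖f ζ‖ ^ 2 : ℝ) : ℂ)) (ha.mul_right (∑' k, ‖a k‖)) (fun k => by fun_prop)
    (fun k ζ hζ => by
      have h1 : ‖ζ‖ = 1 := by simpa using hζ
      have := mul_le_mul_of_nonneg_left (hb ζ hζ) (norm_nonneg (a k))
      simpa [h1] using this)
    (fun ζ hζ => by
      have h1 := (((Complex.hasSum_conj').2 (hf ζ hζ)).mul_left (f ζ))
      rw [show f ζ * conj (f ζ) = ((‖f ζ‖ ^ 2 : ℝ) : ℂ) by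
        rw [Complex.mul_conj, Complex.normSq_eq_norm_sq]] at h1
      refine h1.congr_fun ?_
      intro k
      simp only [map_mul, map_pow]
      ring)
  rw [circleAverage_ofReal] at h
  rw [← Complex.hasSum_ofReal]
  refine h.congr_fun ?_
  intro k
  have := Real.circleAverage_fun_smul (a := conj (a k)) (f := fun ζ : ℂ => f ζ * conj ζ ^ k)
      (c := 0) (R := 1)
  simp only [smul_eq_mul] at this
  rw [this, circleAverage_mul_conj_pow ha hf, mul_comm, Complex.mul_conj, Complex.normSq_eq_norm_sq]

/-! ### A beta integral and the summation by parts -/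

theorem integral_pow_mul_one_sub_sq_pow (m n : ℕ) :
    ∫ r in (0 : ℝ)..1, r * (1 - r ^ 2) ^ n * r ^ (2 * m)
      = (m.factorial * n.factorial : ℝ) / (2 * (m + n + 1).factorial) := by
  induction n generalizing m with
  | zero =>
    have : ∀ r : ℝ, r * (1 - r ^ 2) ^ 0 * r ^ (2 * m) = r ^ (2 * m + 1) := by intro r; ring
    simp only [this, integral_pow]
    simp only [Nat.factorial_succ, Nat.factorial_zero, add_zero]
    push_cast
    have := Nat.factorial_pos m
    field_simp
    simp
    ring
  | succ n ih =>
    have h : ∀ r : ℝ, r * (1 - r ^ 2) ^ (n + 1) * r ^ (2 * m)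
        = r * (1 - r ^ 2) ^ n * r ^ (2 * m) - r * (1 - r ^ 2) ^ n * r ^ (2 * (m + 1)) := by
      intro r; ring
    simp only [h]
    rw [intervalIntegral.integral_sub (Continuous.intervalIntegrable (by fun_prop) _ _)
      (Continuous.intervalIntegrable (by fun_prop) _ _), ih, ih,
      show m + (n + 1) + 1 = m + n + 1 + 1 by ring, show m + 1 + n + 1 = m + n + 1 + 1 by ring,
      Nat.factorial_succ (m + n + 1), Nat.factorial_succ m, Nat.factorial_succ n]
    have := Nat.factorial_pos (m + n + 1)
    push_cast
    field_simp
    ring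

/-- The finite form of the summation-by-parts identity behind the local Douglas formula. -/
theorem sum_norm_sq_weighted_difference (n : ℕ) (c : ℕ → ℂ) (M : ℕ) :
    ∑ m ∈ Finset.range M, (m.factorial / (m + n + 2).factorial : ℝ) *
        ‖∑ k ∈ Finset.range (m + 1), ((k + n + 1).factorial / k.factorial : ℂ) *
          (c k - c (k + 1))‖ ^ 2
      = ∑ k ∈ Finset.range (M + 1), ((k + n).factorial / k.factorial : ℝ) * ‖c k‖ ^ 2
        - (n + 1) * (M.factorial / (M + n + 1).factorial : ℝ) *
          ‖∑ k ∈ Finset.range (M + 1), ((k + n).factorial / k.factorial : ℂ) * c k‖ ^ 2 := by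
  -- With `v_k = (k+n)!/k!`, the weight `(k+n+1)!/k!` equals both `(k+n+1) v_k` and `(k+1) v_{k+1}`,
  -- so the sum telescopes into two consecutive partial sums of `v_k c_k`. The induction on `M` then
  -- only needs algebra.
  have hS : ∀ m : ℕ, ∑ k ∈ Finset.range (m + 1), ((k + n + 1).factorial / k.factorial : ℂ) *
          (c k - c (k + 1))
      = (n + m + 2) * ∑ k ∈ Finset.range (m + 1), ((k + n).factorial / k.factorial : ℂ) * c k
        - (m + 1) * ∑ k ∈ Finset.range (m + 2), ((k + n).factorial / k.factorial : ℂ) * c k := by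
    intro m
    induction m with
    | zero =>
      simp only [Finset.sum_range_succ, Finset.sum_range_zero, Nat.factorial_succ,
        Nat.factorial_zero, show 0 + 1 + n = n + 1 by ring,
        show 0 + n = n by ring]
      push_cast
      ring
    | succ m ih =>
      rw [Finset.sum_range_succ, ih, Finset.sum_range_succ _ (m + 2), Finset.sum_range_succ _ (m + 1),
        show m + 1 + n + 1 = (m + n + 1) + 1 by ring, show m + 2 + n = (m + n + 1) + 1 by ring,
        show m + 1 + n = m + n + 1 by ring, show m + 2 = (m + 1) + 1 by ring,
        Nat.factorial_succ (m + n + 1), Nat.factorial_succ (m + 1), Nat.factorial_succ m]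
      have := Nat.factorial_pos (m + n + 1)
      have h1 : (m.factorial : ℂ) ≠ 0 := by exact_mod_cast (Nat.factorial_pos m).ne'
      have h2 : (m : ℂ) + 1 ≠ 0 := by exact_mod_cast (Nat.succ_ne_zero m)
      have h3 : (m : ℂ) + 1 + 1 ≠ 0 := by exact_mod_cast (Nat.succ_ne_zero (m + 1))
      push_cast
      field_simp
      ring
  induction M with
  | zero =>
    simp only [Finset.sum_range_succ, Finset.sum_range_zero, Nat.factorial_zero, zero_add,
      Nat.factorial_succ]
    have := Nat.factorial_pos n
    push_cast
    rw [norm_mul]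
    simp
    field_simp
    ring
  | succ M ih =>
    rw [Finset.sum_range_succ, ih, hS, Finset.sum_range_succ _ (M + 1)]
    set x := ∑ k ∈ Finset.range (M + 1), ((k + n).factorial / k.factorial : ℂ) * c k
    set s := ∑ k ∈ Finset.range (M + 1), ((k + n).factorial / k.factorial : ℝ) * ‖c k‖ ^ 2
    rw [Finset.sum_range_succ _ (M + 1)]
    change _ = (s + _) - _ * ‖x + _‖ ^ 2
    rw [show M + 1 + n + 1 = (M + n + 1) + 1 by ring, show M + n + 2 = (M + n + 1) + 1 by ring,
        show M + 1 + n = M + n + 1 by ring,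
        Nat.factorial_succ (M + n + 1), Nat.factorial_succ M]
    -- In real and imaginary parts, with the factorials replaced by nonzero `A` and `B`, what
    -- remains is a rational identity over the reals.
    have hx : ∀ z : ℂ, ‖z‖ ^ 2 = z.re ^ 2 + z.im ^ 2 := by
      intro z; rw [← Complex.normSq_eq_norm_sq, Complex.normSq_apply]; ring
    have hA : (M.factorial : ℝ) ≠ 0 := by exact_mod_cast (Nat.factorial_pos M).ne'
    have hB : ((M + n + 1).factorial : ℝ) ≠ 0 := by exact_mod_cast (Nat.factorial_pos _).ne'
    obtain ⟨A, hAM⟩ : ∃ A : ℝ, (M.factorial : ℝ) = A := ⟨_, rfl⟩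
    obtain ⟨B, hBM⟩ : ∃ B : ℝ, ((M + n + 1).factorial : ℝ) = B := ⟨_, rfl⟩
    rw [hAM] at hA
    rw [hBM] at hB
    have e1 : (((M + n + 1).factorial : ℂ) / (((M + 1) * M.factorial : ℕ) : ℂ))
        = ((B / ((M + 1) * A) : ℝ) : ℂ) := by
      simp [← hAM, ← hBM]
    have e2 : ((n : ℂ) + M + 2) * x - (M + 1) * (x + ((B / ((M + 1) * A) : ℝ) : ℂ) * c (M + 1))
        = ((n + 1 : ℝ) : ℂ) * x - ((B / A : ℝ) : ℂ) * c (M + 1) := by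
      have h2 : (M : ℂ) + 1 ≠ 0 := by exact_mod_cast (Nat.succ_ne_zero M)
      have hA' : (A : ℂ) ≠ 0 := by exact_mod_cast hA
      push_cast
      field_simp
      ring
    rw [e1, e2, hx, hx, hx, hx]
    simp only [Complex.sub_re, Complex.sub_im, Complex.add_re, Complex.add_im, Complex.re_ofReal_mul,
      Complex.im_ofReal_mul]
    push_cast
    rw [hAM, hBM]
    field_simp
    ring

/-- The boundary term of the finite identity vanishes in the limit: its sum stays bounded by `K`,
and its factor is at most `(n+1)/(M+1)`. -/
theorem hasSum_norm_sq_weighted_difference (n : ℕ) (c : ℕ → ℂ)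
    (hc : Summable fun k => ((k + n).factorial / k.factorial : ℝ) * ‖c k‖) :
    HasSum (fun m : ℕ => (m.factorial / (m + n + 2).factorial : ℝ) *
        ‖∑ k ∈ Finset.range (m + 1), ((k + n + 1).factorial / k.factorial : ℂ) *
          (c k - c (k + 1))‖ ^ 2)
      (∑' k : ℕ, ((k + n).factorial / k.factorial : ℝ) * ‖c k‖ ^ 2) := by
  have hv : ∀ k : ℕ, (1 : ℝ) ≤ (k + n).factorial / k.factorial := fun k => by
    rw [one_le_div (by exact_mod_cast Nat.factorial_pos k)]
    exact_mod_cast Nat.factorial_le (by omega)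
  set K := ∑' k : ℕ, ((k + n).factorial / k.factorial : ℝ) * ‖c k‖
  have hpos : ∀ k : ℕ, 0 ≤ ((k + n).factorial / k.factorial : ℝ) * ‖c k‖ := fun k => by positivity
  have hcK : ∀ k, ‖c k‖ ≤ K := fun k =>
    (le_mul_of_one_le_left (norm_nonneg _) (hv k)).trans (hc.le_tsum k fun j _ => hpos j)
  have hsq : Summable fun k : ℕ => ((k + n).factorial / k.factorial : ℝ) * ‖c k‖ ^ 2 := by
    refine Summable.of_nonneg_of_le (fun k => by positivity) (fun k => ?_) (hc.mul_right K)
    rw [sq, ← mul_assoc]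
    exact mul_le_mul_of_nonneg_left (hcK k) (hpos k)
  rw [hasSum_iff_tendsto_nat_of_nonneg (fun m => by positivity)]
  simp only [sum_norm_sq_weighted_difference]
  have h1 := (hsq.hasSum.tendsto_sum_nat).comp (tendsto_add_atTop_nat 1)
  have h2 : Tendsto (fun M : ℕ => ((n + 1) * (M.factorial / (M + n + 1).factorial : ℝ) *
          ‖∑ k ∈ Finset.range (M + 1), ((k + n).factorial / k.factorial : ℂ) * c k‖ ^ 2))
      atTop (𝓝 0) := by
    have h3 : Tendsto (fun M : ℕ => (n + 1) * K ^ 2 * (1 / ((M : ℝ) + 1))) atTop (𝓝 0) := by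
      simpa only [mul_zero] using
        (tendsto_one_div_add_atTop_nhds_zero_nat (𝕜 := ℝ)).const_mul (((n : ℝ) + 1) * K ^ 2)
    refine squeeze_zero (fun M => by positivity) (fun M => ?_) h3
    have hV : ‖∑ k ∈ Finset.range (M + 1), ((k + n).factorial / k.factorial : ℂ) * c k‖ ≤ K := by
      refine (norm_sum_le _ _).trans ?_
      refine (Finset.sum_le_sum fun k _ => ?_).trans (hc.sum_le_tsum _ fun j _ => hpos j)
      simp
    have hf : (M.factorial / (M + n + 1).factorial : ℝ) ≤ 1 / ((M : ℝ) + 1) := by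
      rw [div_le_div_iff₀ (by positivity) (by positivity)]
      have : (M + 1).factorial ≤ (M + n + 1).factorial := Nat.factorial_le (by omega)
      rw [Nat.factorial_succ] at this
      have : (((M + 1) * M.factorial : ℕ) : ℝ) ≤ (M + n + 1).factorial := by exact_mod_cast this
      push_cast at this
      linarith
    calc _ ≤ ((n : ℝ) + 1) * (1 / ((M : ℝ) + 1)) * K ^ 2 := by gcongr
      _ = _ := by ring
  simpa using h1.sub h2

/-! ### Power series in the disc: circle means and weighted Bergman norms -/

theorem summable_norm_mul_pow {a : ℕ → ℂ} {f : ℂ → ℂ}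
    (hf : ∀ z ∈ Metric.ball (0 : ℂ) 1, HasSum (fun k => a k * z ^ k) (f z)) {r : ℝ}
    (hr0 : 0 ≤ r) (hr : r < 1) : Summable fun k => ‖a k * (r : ℂ) ^ k‖ :=
  (hf r (by simpa [abs_of_nonneg hr0] using hr)).summable.norm

theorem hasSum_norm_sq_circleAverage_radius {a : ℕ → ℂ} {f : ℂ → ℂ} (hm : Measurable f)
    (hf : ∀ z ∈ Metric.ball (0 : ℂ) 1, HasSum (fun k => a k * z ^ k) (f z)) {r : ℝ}
    (hr0 : 0 ≤ r) (hr : r < 1) :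
    HasSum (fun k => ‖a k‖ ^ 2 * r ^ (2 * k)) (Real.circleAverage (fun ζ => ‖f ζ‖ ^ 2) 0 r) := by
  rw [Real.circleAverage_eq_circleAverage_zero_one]
  have := hasSum_norm_sq_circleAverage (a := fun k => a k * (r : ℂ) ^ k)
    (f := fun z => f (r * z + 0)) (by fun_prop) (summable_norm_mul_pow hf hr0 hr) (fun ζ hζ => by
      have h1 : ‖ζ‖ = 1 := by simpa using hζ
      have := hf (r * ζ + 0) (by simpa [abs_of_nonneg hr0, h1] using hr)
      simpa [mul_pow, mul_assoc] using this)
  refine this.congr_fun ?_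
  intro k
  simp [mul_pow, abs_of_nonneg hr0, ← pow_mul, mul_comm]

theorem lintegral_norm_sq_circle {a : ℕ → ℂ} {f : ℂ → ℂ} (hm : Measurable f)
    (hf : ∀ z ∈ Metric.ball (0 : ℂ) 1, HasSum (fun k => a k * z ^ k) (f z)) {r : ℝ}
    (hr0 : 0 ≤ r) (hr : r < 1) :
    ∫⁻ θ in Set.Ioo (-Real.pi) Real.pi, ENNReal.ofReal (‖f (circleMap 0 r θ)‖ ^ 2)
      = ENNReal.ofReal (2 * Real.pi * ∑' k, ‖a k‖ ^ 2 * r ^ (2 * k)) := by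
  have hs := summable_norm_mul_pow hf hr0 hr
  have hb : ∀ θ, ‖f (circleMap 0 r θ)‖ ≤ ∑' k, ‖a k * (r : ℂ) ^ k‖ := by
    intro θ
    have := hf (circleMap 0 r θ) (by simpa [abs_of_nonneg hr0] using hr)
    rw [← this.tsum_eq]
    refine (norm_tsum_le_tsum_norm ?_).trans_eq ?_
    · simpa using hs
    · simp
  have hint : Integrable (fun θ => ‖f (circleMap 0 r θ)‖ ^ 2)
      (volume.restrict (Set.Ioo (-Real.pi) Real.pi)) := by
    refine Integrable.of_bound (C := (∑' k, ‖a k * (r : ℂ) ^ k‖) ^ 2) ?_ ?_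
    · exact ((hm.comp (continuous_circleMap 0 r).measurable).norm.pow_const 2).aestronglyMeasurable
    · refine Eventually.of_forall fun θ => ?_
      simpa using pow_le_pow_left₀ (norm_nonneg _) (hb θ) 2
  rw [← ofReal_integral_eq_lintegral_ofReal hint (Eventually.of_forall fun θ => by positivity)]
  congr 1
  rw [(hasSum_norm_sq_circleAverage_radius hm hf hr0 hr).tsum_eq, Real.circleAverage_def,
    ← integral_Ioc_eq_integral_Ioo,
    ← intervalIntegral.integral_of_le (by linarith [Real.pi_pos])]
  -- Polar coordinates use angles in `(-π, π)`, circle averages use `[0, 2π]`.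
  have hp : Function.Periodic (fun θ => ‖f (circleMap 0 r θ)‖ ^ 2) (2 * Real.pi) := by
    intro θ; simp [periodic_circleMap 0 r θ]
  have := hp.intervalIntegral_add_eq (-Real.pi) 0
  rw [show -Real.pi + 2 * Real.pi = Real.pi by ring, zero_add] at this
  rw [this, smul_eq_mul]
  have := Real.pi_pos
  field_simp

/-- Orthogonality of the monomials in the weighted Bergman spaces of the disc. -/
theorem lintegral_ball_norm_sq {a : ℕ → ℂ} {f : ℂ → ℂ} (hm : Measurable f)
    (hf : ∀ z ∈ Metric.ball (0 : ℂ) 1, HasSum (fun k => a k * z ^ k) (f z)) (n : ℕ) :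
    ∫⁻ z in Metric.ball (0 : ℂ) 1, ENNReal.ofReal (‖f z‖ ^ 2 * (1 - ‖z‖ ^ 2) ^ n)
      = ∑' m : ℕ, ENNReal.ofReal
          (Real.pi * (‖a m‖ ^ 2 * (m.factorial * n.factorial / (m + n + 1).factorial))) := by
  set G : ℂ → ENNReal := (Metric.ball (0 : ℂ) 1).indicator
    fun z => ENNReal.ofReal (‖f z‖ ^ 2 * (1 - ‖z‖ ^ 2) ^ n) with hG
  have hGm : Measurable G := by
    apply Measurable.indicator _ measurableSet_ball
    fun_prop
  rw [← lintegral_indicator measurableSet_ball, ← Complex.lintegral_comp_polarCoord_symm]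
  rw [show polarCoord.target = Set.Ioi (0 : ℝ) ×ˢ Set.Ioo (-Real.pi) Real.pi from rfl,
    Measure.volume_eq_prod, ← Measure.prod_restrict, lintegral_prod _ (by
      apply Measurable.aemeasurable
      simp only [smul_eq_mul]
      apply Measurable.mul (by fun_prop)
      have : Measurable fun p : ℝ × ℝ => Complex.polarCoord.symm p := by
        simp only [Complex.polarCoord_symm_apply]
        fun_prop
      exact hGm.comp this)]
  have hin : ∀ r ∈ Set.Ioi (0 : ℝ), ∫⁻ θ in Set.Ioo (-Real.pi) Real.pi,
      ENNReal.ofReal r • G (Complex.polarCoord.symm (r, θ))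
        = (Set.Ioo (0 : ℝ) 1).indicator (fun r => ∑' k : ℕ, ENNReal.ofReal
            (2 * Real.pi * ‖a k‖ ^ 2 * (r * (1 - r ^ 2) ^ n * r ^ (2 * k)))) r := by
    intro r hr
    have hr0 : 0 < r := hr
    have hcm : ∀ θ, Complex.polarCoord.symm (r, θ) = circleMap 0 r θ := by
      intro θ
      simp [circleMap, Complex.exp_mul_I]
    simp only [hcm]
    by_cases hr1 : r < 1
    · have hw : 0 ≤ 1 - r ^ 2 := by nlinarith
      rw [Set.indicator_of_mem (show r ∈ Set.Ioo (0 : ℝ) 1 from ⟨hr0, hr1⟩)]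
      have h1 : ∀ θ, ENNReal.ofReal r • G (circleMap 0 r θ)
          = ENNReal.ofReal (r * (1 - r ^ 2) ^ n) * ENNReal.ofReal (‖f (circleMap 0 r θ)‖ ^ 2) := by
        intro θ
        rw [hG, Set.indicator_of_mem (by simpa [abs_of_pos hr0] using hr1), smul_eq_mul,
          ← ENNReal.ofReal_mul hr0.le, ← ENNReal.ofReal_mul (by positivity)]
        simp only [norm_circleMap_zero, sq_abs]
        ring_nf
      simp only [h1]
      have hs := (hasSum_norm_sq_circleAverage_radius hm hf hr0.le hr1).summable
      rw [lintegral_const_mul' _ _ ENNReal.ofReal_ne_top, lintegral_norm_sq_circle hm hf hr0.le hr1,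
        ← ENNReal.ofReal_mul (by positivity), ← ENNReal.ofReal_tsum_of_nonneg
          (fun k => by have := Real.pi_pos; positivity)]
      · rw [← tsum_mul_left, ← tsum_mul_left]
        congr 2
        ext1 k
        ring
      · refine (hs.mul_left (2 * Real.pi * (r * (1 - r ^ 2) ^ n))).congr fun k => ?_
        ring
    · rw [Set.indicator_of_notMem (fun h => hr1 h.2)]
      have h1 : ∀ θ, ENNReal.ofReal r • G (circleMap 0 r θ) = 0 := by
        intro θ
        rw [hG, Set.indicator_of_notMem (by simpa [abs_of_pos hr0] using hr1), smul_zero]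
      simp only [h1, lintegral_zero]
  rw [setLIntegral_congr_fun measurableSet_Ioi hin, setLIntegral_indicator measurableSet_Ioo,
    Set.inter_eq_left.2 Set.Ioo_subset_Ioi_self, lintegral_tsum (fun k => by fun_prop)]
  congr 1
  ext1 m
  have hnn : ∀ r ∈ Set.Ioo (0 : ℝ) 1,
      0 ≤ 2 * Real.pi * ‖a m‖ ^ 2 * (r * (1 - r ^ 2) ^ n * r ^ (2 * m)) := by
    intro r hr
    have : 0 ≤ 1 - r ^ 2 := by nlinarith [hr.1, hr.2.le]
    have := hr.1.le
    have := Real.pi_pos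
    positivity
  rw [← ofReal_integral_eq_lintegral_ofReal
    ((Continuous.integrableOn_Icc (by fun_prop)).mono_set Set.Ioo_subset_Icc_self)
    ((ae_restrict_iff' measurableSet_Ioo).2 (Eventually.of_forall hnn)),
    ← integral_Ioc_eq_integral_Ioo, ← intervalIntegral.integral_of_le zero_le_one,
    intervalIntegral.integral_const_mul,
    integral_pow_mul_one_sub_sq_pow]
  congr 1
  field_simp

/-! ### Taylor coefficients of functions smooth up to the boundary -/

/-- Since `f` is arbitrary off the closed disc, `deriv f` is not controlled on the circle; the real
derivative within the closed disc, in direction `1`, is a smooth substitute. -/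
theorem SmoothAnalytic.exists_eqOn_deriv {f : ℂ → ℂ} (hf : f ∈ SmoothAnalytic) :
    ∃ g ∈ SmoothAnalytic, Set.EqOn g (deriv f) (Metric.ball 0 1) := by
  have heq : Set.EqOn (fun z => fderivWithin ℝ f (Metric.closedBall 0 1) z 1) (deriv f)
      (Metric.ball 0 1) := by
    intro z hz
    have hd : DifferentiableAt ℂ f z := hf.1.differentiableAt (Metric.isOpen_ball.mem_nhds hz)
    have hn : Metric.closedBall (0 : ℂ) 1 ∈ 𝓝 z :=
      mem_of_superset (Metric.isOpen_ball.mem_nhds hz) Metric.ball_subset_closedBall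
    simp only
    rw [fderivWithin_of_mem_nhds hn, hd.fderiv_restrictScalars ℝ]
    simp
  refine ⟨_, ⟨?_, ?_⟩, heq⟩
  · exact (hf.1.deriv Metric.isOpen_ball).congr heq
  · have hu : UniqueDiffOn ℝ (Metric.closedBall (0 : ℂ) 1) :=
      uniqueDiffOn_convex (convex_closedBall 0 1) (by
        rw [interior_closedBall _ one_ne_zero]; exact ⟨0, by simp⟩)
    exact (hf.2.fderivWithin hu (m := ∞) (by simp)).clm_apply contDiffOn_const

theorem SmoothAnalytic.exists_eqOn_iteratedDeriv {f : ℂ → ℂ} (hf : f ∈ SmoothAnalytic) (n : ℕ) :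
    ∃ g ∈ SmoothAnalytic, Set.EqOn g (iteratedDeriv n f) (Metric.ball 0 1) := by
  induction n with
  | zero => exact ⟨f, hf, fun z _ => by simp⟩
  | succ n ih =>
    obtain ⟨g, hg, hgf⟩ := ih
    obtain ⟨g', hg', hgg⟩ := SmoothAnalytic.exists_eqOn_deriv hg
    refine ⟨g', hg', hgg.trans ?_⟩
    rw [iteratedDeriv_succ]
    exact hgf.deriv Metric.isOpen_ball

/-- The `k`-th Taylor coefficient of `f` at the origin. -/
def taylorCoef (f : ℂ → ℂ) (k : ℕ) : ℂ := iteratedDeriv k f 0 / k.factorial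

theorem iteratedDeriv_iteratedDeriv (k n : ℕ) (f : ℂ → ℂ) :
    iteratedDeriv k (iteratedDeriv n f) = iteratedDeriv (k + n) f := by
  simp only [iteratedDeriv_eq_iterate, Function.iterate_add_apply]

theorem taylorCoef_iteratedDeriv (k n : ℕ) (f : ℂ → ℂ) :
    taylorCoef (iteratedDeriv n f) k
      = ((k + n).factorial / k.factorial : ℂ) * taylorCoef f (k + n) := by
  have : ((k + n).factorial : ℂ) ≠ 0 := by exact_mod_cast (Nat.factorial_pos _).ne'
  simp only [taylorCoef, iteratedDeriv_iteratedDeriv]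
  field_simp

theorem hasSum_taylorCoef {f : ℂ → ℂ} (hf : DifferentiableOn ℂ f (Metric.ball 0 1)) {z : ℂ}
    (hz : z ∈ Metric.ball (0 : ℂ) 1) : HasSum (fun k => taylorCoef f k * z ^ k) (f z) := by
  refine (Complex.hasSum_taylorSeries_on_ball hf hz).congr_fun ?_
  intro k
  simp [taylorCoef]
  ring

/-- Cauchy's estimate on the unit circle for the `n`-th derivative, whose `k`-th coefficient carries
the factor `(k+n)!/k! ≥ (k+1)^n`. -/
theorem SmoothAnalytic.exists_norm_taylorCoef_le {f : ℂ → ℂ} (hf : f ∈ SmoothAnalytic) (n : ℕ) :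
    ∃ C, ∀ k : ℕ, ((k : ℝ) + 1) ^ n * ‖taylorCoef f (k + n)‖ ≤ C := by
  obtain ⟨g, hg, hgf⟩ := SmoothAnalytic.exists_eqOn_iteratedDeriv hf n
  obtain ⟨C, hC⟩ := (isCompact_closedBall (0 : ℂ) 1).exists_bound_of_continuousOn hg.2.continuousOn
  refine ⟨C, fun k => ?_⟩
  have hd : DiffContOnCl ℂ g (Metric.ball 0 1) :=
    ⟨hg.1, by rw [closure_ball _ one_ne_zero]; exact hg.2.continuousOn⟩
  have h1 := Complex.norm_iteratedDeriv_le_of_forall_mem_sphere_norm_le k one_pos hd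
    (fun z hz => hC z (Metric.sphere_subset_closedBall hz))
  rw [one_pow, div_one] at h1
  have h2 : iteratedDeriv k g 0 = iteratedDeriv k (iteratedDeriv n f) 0 :=
    (hgf.eventuallyEq_of_mem (Metric.ball_mem_nhds 0 one_pos)).iteratedDeriv_eq k
  have h3 : ‖taylorCoef (iteratedDeriv n f) k‖ ≤ C := by
    rw [taylorCoef, ← h2, norm_div, Complex.norm_natCast, div_le_iff₀ (by positivity)]
    linarith
  rw [taylorCoef_iteratedDeriv, norm_mul] at h3
  refine (mul_le_mul_of_nonneg_right ?_ (norm_nonneg _)).trans h3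
  rw [norm_div, Complex.norm_natCast, Complex.norm_natCast, le_div_iff₀ (by positivity)]
  have h4 := Nat.pow_succ_le_ascFactorial (k + 1) n
  have h5 := Nat.factorial_mul_ascFactorial k n
  rw [← h5]
  push_cast
  rw [mul_comm]
  gcongr
  exact_mod_cast h4

/-- The sequence `a` decays faster than every power of its index. -/
def RapidDecay (a : ℕ → ℂ) : Prop := ∀ n : ℕ, Summable fun k : ℕ => ((k : ℝ) + 1) ^ n * ‖a k‖

theorem RapidDecay.summable {a : ℕ → ℂ} (ha : RapidDecay a) : Summable fun k => ‖a k‖ := by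
  simpa using ha 0

theorem summable_one_div_succ_sq (C : ℝ) : Summable fun k : ℕ => C * (1 / ((k : ℝ) + 1) ^ 2) := by
  apply Summable.mul_left
  have := (summable_nat_add_iff 1).2 (Real.summable_one_div_nat_pow.2 one_lt_two)
  simpa using this

theorem SmoothAnalytic.rapidDecay {f : ℂ → ℂ} (hf : f ∈ SmoothAnalytic) :
    RapidDecay (taylorCoef f) := by
  intro n
  -- The two spare powers leave the convergent series `∑ 1/(k+1)²`.
  obtain ⟨C, hC⟩ := SmoothAnalytic.exists_norm_taylorCoef_le hf (n + 2)
  rw [← summable_nat_add_iff (n + 2)]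
  refine Summable.of_nonneg_of_le (fun k => by positivity) (fun k => ?_)
    (summable_one_div_succ_sq (((n : ℝ) + 3) ^ n * C))
  have h1 : (((k + (n + 2) : ℕ) : ℝ) + 1) ≤ (n + 3) * (k + 1) := by
    push_cast
    nlinarith [mul_nonneg (Nat.cast_nonneg (α := ℝ) n) (Nat.cast_nonneg (α := ℝ) k),
      Nat.cast_nonneg (α := ℝ) k]
  have h2 : ‖taylorCoef f (k + (n + 2))‖ ≤ C / ((k : ℝ) + 1) ^ (n + 2) := by
    rw [le_div_iff₀ (by positivity)]
    linarith [hC k]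
  calc _ ≤ ((n + 3) * ((k : ℝ) + 1)) ^ n * (C / ((k : ℝ) + 1) ^ (n + 2)) := by gcongr
    _ = _ := by rw [mul_pow, pow_add]; field_simp

/-- Series and function are both continuous on the closed disc and agree on its dense interior. -/
theorem SmoothAnalytic.hasSum_taylorCoef {f : ℂ → ℂ} (hf : f ∈ SmoothAnalytic) {z : ℂ}
    (hz : z ∈ Metric.closedBall (0 : ℂ) 1) : HasSum (fun k => taylorCoef f k * z ^ k) (f z) := by
  have hle : ∀ (k : ℕ), ∀ w ∈ Metric.closedBall (0 : ℂ) 1,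
      ‖taylorCoef f k * w ^ k‖ ≤ ‖taylorCoef f k‖ := by
    intro k w hw
    rw [norm_mul, norm_pow]
    exact mul_le_of_le_one_right (norm_nonneg _) (pow_le_one₀ (norm_nonneg _) (by simpa using hw))
  have hs := (SmoothAnalytic.rapidDecay hf).summable
  have hc : ContinuousOn (fun w => ∑' k, taylorCoef f k * w ^ k) (Metric.closedBall 0 1) :=
    continuousOn_tsum (fun k => by fun_prop) hs hle
  have heq : Set.EqOn (fun w => ∑' k, taylorCoef f k * w ^ k) f (Metric.closedBall 0 1) := by
    refine Set.EqOn.of_subset_closure (s := Metric.ball 0 1) ?_ hc hf.2.continuousOn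
      Metric.ball_subset_closedBall (closure_ball (0 : ℂ) one_ne_zero).ge
    intro w hw
    exact (DirichletInt.hasSum_taylorCoef hf.1 hw).tsum_eq
  rw [← heq hz]
  exact (Summable.of_norm_bounded hs fun k => hle k z hz).hasSum

theorem fourierCoef_eq {a : ℕ → ℂ} {f : ℂ → ℂ} (ha : Summable fun k => ‖a k‖)
    (hf : ∀ ζ ∈ Metric.sphere (0 : ℂ) 1, HasSum (fun k => a k * ζ ^ k) (f ζ)) (m : ℕ) :
    fourierCoef f m = a m := by
  rw [← circleAverage_mul_conj_pow ha hf m]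
  simp [fourierCoef]

theorem SmoothAnalytic.fourierCoef_eq {f : ℂ → ℂ} (hf : f ∈ SmoothAnalytic) (m : ℕ) :
    fourierCoef f m = taylorCoef f m :=
  DirichletInt.fourierCoef_eq (SmoothAnalytic.rapidDecay hf).summable
    (fun _ hζ => SmoothAnalytic.hasSum_taylorCoef hf (Metric.sphere_subset_closedBall hζ)) m

theorem SmoothAnalytic.taylorCoef_mulZ {f : ℂ → ℂ} (hf : f ∈ SmoothAnalytic) (m : ℕ) :
    taylorCoef (mulZ f) m = Nat.casesOn m 0 (taylorCoef f) := by
  rw [← SmoothAnalytic.fourierCoef_eq (mulZ_mem hf)]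
  refine DirichletInt.fourierCoef_eq (a := fun m => Nat.casesOn m 0 (taylorCoef f)) ?_ ?_ m
  · rw [← summable_nat_add_iff 1]
    exact (SmoothAnalytic.rapidDecay hf).summable
  · intro ζ hζ
    rw [← hasSum_nat_add_iff' 1]
    have := (SmoothAnalytic.hasSum_taylorCoef hf (Metric.sphere_subset_closedBall hζ)).mul_left ζ
    simp only [Finset.sum_range_one, mulZ]
    change HasSum _ (ζ * f ζ - 0 * ζ ^ 0)
    rw [zero_mul, sub_zero]
    refine this.congr_fun ?_
    intro k
    ring

/-! ### Tails and the local Dirichlet integral -/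

/-- The Taylor coefficients, up to a shift of index, of the difference quotients of
`∑ a k * z ^ k` at the point `w` of the unit circle. -/
def tail (a : ℕ → ℂ) (k : ℕ) (w : ℂ) : ℂ := ∑' j, a (k + j) * w ^ j

theorem RapidDecay.summable_shift {a : ℕ → ℂ} (ha : RapidDecay a) (k : ℕ) :
    Summable fun j => ‖a (k + j)‖ := by
  simpa [add_comm] using (summable_nat_add_iff k).2 ha.summable

theorem norm_tail_le {a : ℕ → ℂ} (ha : RapidDecay a) (k : ℕ) {w : ℂ} (hw : ‖w‖ = 1) :
    ‖tail a k w‖ ≤ ∑' j, ‖a (k + j)‖ := by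
  refine (norm_tsum_le_tsum_norm ?_).trans_eq ?_ <;> simp [hw, ha.summable_shift k]

/-- Used twice: to write coefficients as differences of tails in the Douglas formula, and to isolate
the Fourier coefficient in the upper bound. -/
theorem tail_eq_add {a : ℕ → ℂ} (ha : RapidDecay a) (k : ℕ) {w : ℂ} (hw : ‖w‖ = 1) :
    tail a k w = a k + w * tail a (k + 1) w := by
  have hs : Summable fun j => a (k + j) * w ^ j :=
    Summable.of_norm (by simpa [hw] using ha.summable_shift k)
  rw [tail, hs.tsum_eq_zero_add, tail, ← tsum_mul_left]
  simp only [add_zero, pow_zero, mul_one]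
  congr 2
  ext1 j
  rw [show k + (j + 1) = k + 1 + j by ring]
  ring

theorem continuous_tail {a : ℕ → ℂ} (ha : RapidDecay a) (k : ℕ) :
    Continuous fun w : Metric.sphere (0 : ℂ) 1 => tail a k w :=
  continuous_tsum (fun j => by fun_prop) (ha.summable_shift k) (fun j w => by simp)

theorem RapidDecay.summable_pow_mul_tsum {a : ℕ → ℂ} (ha : RapidDecay a) (n : ℕ) :
    Summable fun k : ℕ => ((k : ℝ) + 1) ^ n * ∑' j, ‖a (k + j)‖ := by
  set C := ∑' k : ℕ, ((k : ℝ) + 1) ^ (n + 2) * ‖a k‖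
  refine Summable.of_nonneg_of_le
    (fun k => mul_nonneg (by positivity) (tsum_nonneg fun j => norm_nonneg _)) (fun k => ?_)
    (summable_one_div_succ_sq C)
  have h1 : ((k : ℝ) + 1) ^ (n + 2) * ∑' j, ‖a (k + j)‖ ≤ C := by
    rw [← tsum_mul_left]
    have hs : Summable fun j : ℕ => (((k + j : ℕ) : ℝ) + 1) ^ (n + 2) * ‖a (k + j)‖ := by
      simpa only [add_comm k] using (summable_nat_add_iff k).2 (ha (n + 2))
    calc ∑' j, ((k : ℝ) + 1) ^ (n + 2) * ‖a (k + j)‖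
        ≤ ∑' j : ℕ, (((k + j : ℕ) : ℝ) + 1) ^ (n + 2) * ‖a (k + j)‖ := by
          refine Summable.tsum_le_tsum (fun j => ?_) ((ha.summable_shift k).mul_left _) hs
          gcongr
          omega
      _ ≤ C := hs.tsum_le_tsum_of_inj (fun j => k + j) (add_right_injective k)
          (fun c _ => by positivity) (fun i => le_rfl) (ha (n + 2))
  have h2 : ∑' j, ‖a (k + j)‖ ≤ C / ((k : ℝ) + 1) ^ (n + 2) := by
    rw [le_div_iff₀ (by positivity)]
    linarith
  calc _ ≤ ((k : ℝ) + 1) ^ n * (C / ((k : ℝ) + 1) ^ (n + 2)) := by gcongr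
    _ = _ := by rw [pow_add]; field_simp

theorem factorial_div_factorial_eq (k n : ℕ) :
    ((k + n).factorial / k.factorial : ℝ) = n.factorial * (k + n).choose n := by
  rw [div_eq_iff (by positivity)]
  have := Nat.add_choose_mul_factorial_mul_factorial k n
  have h : (((k + n).choose n * k.factorial * n.factorial : ℕ) : ℝ) = (k + n).factorial := by
    exact_mod_cast this
  push_cast at h
  linarith

theorem choose_add_le_pow (k n i : ℕ) : ((k + n).choose n : ℝ) ≤ (((k + n + i : ℕ) : ℝ) + 1) ^ n := by
  have h1 := Nat.choose_le_pow (k + n) n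
  have : (k + n) ^ n ≤ (k + n + i + 1) ^ n := Nat.pow_le_pow_left (by omega) n
  exact_mod_cast h1.trans this

theorem RapidDecay.summable_choose_mul {a : ℕ → ℂ} (ha : RapidDecay a) (n i : ℕ) :
    Summable fun k : ℕ => ((k + n).choose n : ℝ) * ∑' j, ‖a (k + n + i + j)‖ := by
  have h0 : ∀ k : ℕ, 0 ≤ ∑' j, ‖a (k + n + i + j)‖ := fun k => tsum_nonneg fun j => norm_nonneg _
  have h := (summable_nat_add_iff (n + i)).2 (ha.summable_pow_mul_tsum n)
  refine Summable.of_nonneg_of_le (fun k => mul_nonneg (by positivity) (h0 k)) (fun k => ?_) h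
  simp only [← add_assoc]
  exact mul_le_mul_of_nonneg_right (choose_add_le_pow k n i) (h0 k)

theorem RapidDecay.summable_choose_mul_sq {a : ℕ → ℂ} (ha : RapidDecay a) (n i : ℕ) :
    Summable fun k : ℕ => ((k + n).choose n : ℝ) * (∑' j, ‖a (k + n + i + j)‖) ^ 2 := by
  refine Summable.of_nonneg_of_le (fun k => by positivity) (fun k => ?_)
    ((ha.summable_choose_mul n i).mul_right (∑' j, ‖a j‖))
  have h0 : 0 ≤ ∑' j, ‖a (k + n + i + j)‖ := tsum_nonneg fun j => norm_nonneg _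
  rw [sq, ← mul_assoc]
  refine mul_le_mul_of_nonneg_left ?_ (mul_nonneg (by positivity) h0)
  exact (ha.summable_shift _).tsum_le_tsum_of_inj _ (add_right_injective (k + n + i))
    (fun c _ => norm_nonneg _) (fun i => le_rfl) ha.summable

theorem RapidDecay.summable_choose_mul_norm_tail_sq {a : ℕ → ℂ} (ha : RapidDecay a) (n i : ℕ) {w : ℂ}
    (hw : ‖w‖ = 1) :
    Summable fun k : ℕ => ((k + n).choose n : ℝ) * ‖tail a (k + n + i) w‖ ^ 2 :=
  Summable.of_nonneg_of_le (fun k => by positivity)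
    (fun k => by gcongr; exact norm_tail_le ha _ hw) (ha.summable_choose_mul_sq n i)

/-- The local Dirichlet integral of order `n + 1` at the point `w` of the unit circle. -/
def localDirichlet (n : ℕ) (a : ℕ → ℂ) (w : ℂ) : ℝ :=
  ∑' k : ℕ, ((k + n).choose n : ℝ) * ‖tail a (k + n + 1) w‖ ^ 2

theorem localDirichlet_nonneg (n : ℕ) (a : ℕ → ℂ) (w : ℂ) : 0 ≤ localDirichlet n a w :=
  tsum_nonneg fun k => by positivity

theorem continuous_localDirichlet {a : ℕ → ℂ} (ha : RapidDecay a) (n : ℕ) :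
    Continuous fun w : Metric.sphere (0 : ℂ) 1 => localDirichlet n a w := by
  refine continuous_tsum (fun k => ?_) (ha.summable_choose_mul_sq n 1) (fun k w => ?_)
  · exact continuous_const.mul ((continuous_tail ha _).norm.pow 2)
  · have := norm_tail_le ha (k + n + 1) (w := w) (by simp)
    rw [Real.norm_of_nonneg (by positivity)]
    gcongr

/-! ### The local Douglas formula -/

/-- Cauchy product with the geometric series of `1/(w - z)`; up to a unimodular factor the
coefficients are partial sums of `g` at `w`. -/
theorem hasSum_mul_inv_sub {d : ℕ → ℂ} {g : ℂ → ℂ} {w : ℂ} (hw : ‖w‖ = 1)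
    (hg : ∀ z ∈ Metric.ball (0 : ℂ) 1, HasSum (fun k => d k * z ^ k) (g z)) :
    ∀ z ∈ Metric.ball (0 : ℂ) 1, HasSum
      (fun m => (w⁻¹ ^ (m + 1) * ∑ k ∈ Finset.range (m + 1), w ^ k * d k) * z ^ m)
      (g z * (w - z)⁻¹) := by
  intro z hz
  have hz1 : ‖z‖ < 1 := by simpa using hz
  have hw0 : w ≠ 0 := by rintro rfl; simp at hw
  have hwz : ‖w⁻¹ * z‖ < 1 := by simpa [hw] using hz1
  have h1 : HasSum (fun k => w⁻¹ * (w⁻¹ * z) ^ k) (w - z)⁻¹ := by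
    have := (hasSum_geometric_of_norm_lt_one hwz).mul_left w⁻¹
    rwa [← mul_inv, mul_sub, mul_one, mul_inv_cancel_left₀ hw0] at this
  have h2 := hasSum_sum_range_mul_of_summable_norm (hg z hz).summable.norm h1.summable.norm
  rw [(hg z hz).tsum_eq, h1.tsum_eq] at h2
  refine h2.congr_fun ?_
  intro m
  rw [Finset.mul_sum, Finset.sum_mul]
  refine Finset.sum_congr rfl fun k hk => ?_
  obtain ⟨j, rfl⟩ := Nat.exists_eq_add_of_le (Nat.lt_succ_iff.1 (Finset.mem_range.1 hk))
  rw [Nat.add_sub_cancel_left, mul_pow]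
  simp only [inv_pow]
  field_simp
  ring

theorem RapidDecay.hasSum_localDirichlet {a : ℕ → ℂ} (ha : RapidDecay a) (n : ℕ) {w : ℂ}
    (hw : ‖w‖ = 1) :
    HasSum (fun m : ℕ => (m.factorial / (m + n + 2).factorial : ℝ) *
        ‖∑ k ∈ Finset.range (m + 1),
          w ^ k * (((k + (n + 1)).factorial / k.factorial : ℂ) * a (k + (n + 1)))‖ ^ 2)
      (n.factorial * localDirichlet n a w) := by
  have h := hasSum_norm_sq_weighted_difference n (fun k => w ^ k * tail a (k + n + 1) w) (by
    simp only [norm_mul, norm_pow, hw, one_pow, one_mul, factorial_div_factorial_eq, mul_assoc]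
    apply Summable.mul_left
    exact Summable.of_nonneg_of_le (fun k => by positivity)
      (fun k => by gcongr; exact norm_tail_le ha _ hw) (ha.summable_choose_mul n 1))
  have e : ∀ k, w ^ k * (((k + (n + 1)).factorial / k.factorial : ℂ) * a (k + (n + 1)))
      = ((k + n + 1).factorial / k.factorial : ℂ) *
        (w ^ k * tail a (k + n + 1) w - w ^ (k + 1) * tail a (k + 1 + n + 1) w) := by
    intro k
    rw [tail_eq_add ha (k + n + 1) hw, show k + 1 + n + 1 = k + n + 1 + 1 by ring,
      show k + (n + 1) = k + n + 1 by ring]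
    ring
  simp only [e]
  convert h using 1
  rw [localDirichlet, ← tsum_mul_left]
  congr 1
  ext1 k
  rw [factorial_div_factorial_eq]
  simp [hw]
  ring

/-- The local Douglas formula of higher order. -/
theorem lintegral_local {f : ℂ → ℂ} (hf : f ∈ SmoothAnalytic) (n : ℕ) {w : ℂ} (hw : ‖w‖ = 1) :
    ∫⁻ z in Metric.ball (0 : ℂ) 1, ENNReal.ofReal
      (‖iteratedDeriv (n + 1) f z‖ ^ 2 * ((1 - ‖z‖ ^ 2) / ‖w - z‖ ^ 2) * (1 - ‖z‖ ^ 2) ^ n)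
      = ENNReal.ofReal ((n + 1).factorial * n.factorial * Real.pi *
          localDirichlet n (taylorCoef f) w) := by
  set g := iteratedDeriv (n + 1) f with hgdef
  have hgm : Measurable g := by
    rw [hgdef, iteratedDeriv_succ]
    exact measurable_deriv _
  have hg : ∀ z ∈ Metric.ball (0 : ℂ) 1, HasSum (fun k : ℕ =>
      (((k + (n + 1)).factorial / k.factorial : ℂ) * taylorCoef f (k + (n + 1))) * z ^ k)
      (g z) := by
    intro z hz
    obtain ⟨G, hG, hGg⟩ := SmoothAnalytic.exists_eqOn_iteratedDeriv hf (n + 1)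
    have := hasSum_taylorCoef (hG.1.congr hGg.symm) hz
    simpa only [taylorCoef_iteratedDeriv] using this
  have h1 := lintegral_ball_norm_sq (f := fun z => g z * (w - z)⁻¹) (by fun_prop)
    (hasSum_mul_inv_sub hw hg) (n + 1)
  -- The numerator of the Poisson kernel raises the exponent of the weight to `n + 1`.
  have h2 : ∀ z, ‖g z‖ ^ 2 * ((1 - ‖z‖ ^ 2) / ‖w - z‖ ^ 2) * (1 - ‖z‖ ^ 2) ^ n
      = ‖g z * (w - z)⁻¹‖ ^ 2 * (1 - ‖z‖ ^ 2) ^ (n + 1) := by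
    intro z
    rw [norm_mul, norm_inv, div_eq_mul_inv]
    ring
  simp only [h2]
  rw [h1]
  have h3 := ((SmoothAnalytic.rapidDecay hf).hasSum_localDirichlet n hw).mul_left
    (Real.pi * (n + 1).factorial)
  rw [show ((n + 1).factorial * n.factorial * Real.pi * localDirichlet n (taylorCoef f) w)
      = (Real.pi * (n + 1).factorial) * (n.factorial * localDirichlet n (taylorCoef f) w) by ring,
    ← h3.tsum_eq, ENNReal.ofReal_tsum_of_nonneg
      (fun k => by have := Real.pi_pos; positivity) h3.summable]
  congr 1
  ext1 m
  congr 1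
  rw [norm_mul, norm_pow, norm_inv, hw, show m + (n + 1) + 1 = m + n + 2 by ring]
  simp only [inv_one, one_pow, one_mul]
  ring

/-! ### Integration over `μ` and the limit for positive order -/

theorem poissonExt_nonneg (μ : Measure (Metric.sphere (0 : ℂ) 1)) {z : ℂ} (hz : ‖z‖ ≤ 1) :
    0 ≤ poissonExt μ z := by
  have : 0 ≤ 1 - ‖z‖ ^ 2 := by nlinarith [norm_nonneg z]
  exact integral_nonneg fun ζ => by positivity

theorem measurable_poissonExt (μ : Measure (Metric.sphere (0 : ℂ) 1)) [IsFiniteMeasure μ] :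
    Measurable (poissonExt μ) := by
  have : StronglyMeasurable (Function.uncurry fun (z : ℂ) (ζ : Metric.sphere (0 : ℂ) 1) =>
      (1 - ‖z‖ ^ 2) / ‖(ζ : ℂ) - z‖ ^ 2) := by
    apply Measurable.stronglyMeasurable
    simp only [Function.uncurry_def]
    fun_prop
  exact this.integral_prod_right.measurable

theorem one_sub_norm_le_norm_sub (ζ : Metric.sphere (0 : ℂ) 1) (z : ℂ) : 1 - ‖z‖ ≤ ‖(ζ : ℂ) - z‖ := by
  have := norm_sub_norm_le (ζ : ℂ) z
  simpa using this

theorem ofReal_poissonExt (μ : Measure (Metric.sphere (0 : ℂ) 1)) [IsFiniteMeasure μ] {z : ℂ}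
    (hz : ‖z‖ < 1) : ENNReal.ofReal (poissonExt μ z)
      = ∫⁻ ζ : Metric.sphere (0 : ℂ) 1, ENNReal.ofReal ((1 - ‖z‖ ^ 2) / ‖(ζ : ℂ) - z‖ ^ 2) ∂μ := by
  have h0 : 0 ≤ 1 - ‖z‖ ^ 2 := by nlinarith [norm_nonneg z]
  refine ofReal_integral_eq_lintegral_ofReal ?_ (Eventually.of_forall fun ζ => by positivity)
  refine Continuous.integrable_of_hasCompactSupport ?_ (HasCompactSupport.of_compactSpace _)
  refine continuous_const.div (by fun_prop) fun ζ => ?_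
  have := one_sub_norm_le_norm_sub ζ z
  have : 0 < ‖(ζ : ℂ) - z‖ := by linarith
  positivity

/-- Lower integrals let Tonelli apply with no prior integrability; the finite value obtained is what
later proves integrability over the disc. -/
theorem lintegral_dirichlet (μ : Measure (Metric.sphere (0 : ℂ) 1)) [IsFiniteMeasure μ]
    {f : ℂ → ℂ} (hf : f ∈ SmoothAnalytic) (n : ℕ) :
    ∫⁻ z in Metric.ball (0 : ℂ) 1, ENNReal.ofReal
      (‖iteratedDeriv (n + 1) f z‖ ^ 2 * poissonExt μ z * (1 - ‖z‖ ^ 2) ^ n)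
      = ENNReal.ofReal ((n + 1).factorial * n.factorial * Real.pi *
          ∫ w : Metric.sphere (0 : ℂ) 1, localDirichlet n (taylorCoef f) w ∂μ) := by
  set g := iteratedDeriv (n + 1) f with hgdef
  have hgm : Measurable g := by
    rw [hgdef, iteratedDeriv_succ]
    exact measurable_deriv _
  have hz : ∀ z ∈ Metric.ball (0 : ℂ) 1,
      ENNReal.ofReal (‖g z‖ ^ 2 * poissonExt μ z * (1 - ‖z‖ ^ 2) ^ n)
      = ∫⁻ ζ : Metric.sphere (0 : ℂ) 1, ENNReal.ofReal
        (‖g z‖ ^ 2 * ((1 - ‖z‖ ^ 2) / ‖(ζ : ℂ) - z‖ ^ 2) * (1 - ‖z‖ ^ 2) ^ n) ∂μ := by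
    intro z hz
    have hz1 : ‖z‖ < 1 := by simpa using hz
    have h0 : 0 ≤ 1 - ‖z‖ ^ 2 := by nlinarith [norm_nonneg z]
    rw [mul_right_comm, ENNReal.ofReal_mul (by positivity), ofReal_poissonExt μ hz1,
      ← lintegral_const_mul' _ _ ENNReal.ofReal_ne_top]
    congr 1
    ext1 ζ
    rw [← ENNReal.ofReal_mul (by positivity), mul_right_comm]
  rw [setLIntegral_congr_fun measurableSet_ball hz, lintegral_lintegral_swap (by
    apply Measurable.aemeasurable
    simp only [Function.uncurry_def]
    fun_prop)]
  have hw : ∀ w : Metric.sphere (0 : ℂ) 1, _ := fun w =>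
    lintegral_local hf n (w := w) (by simp)
  simp only [hgdef, hw]
  have hc := continuous_localDirichlet (SmoothAnalytic.rapidDecay hf) n
  rw [← integral_const_mul]
  refine (ofReal_integral_eq_lintegral_ofReal ?_ (Eventually.of_forall fun w => ?_)).symm
  · exact (continuous_const.mul hc).integrable_of_hasCompactSupport
      (HasCompactSupport.of_compactSpace _)
  · have := Real.pi_pos
    have := localDirichlet_nonneg n (taylorCoef f) w
    positivity

theorem tendsto_setIntegral_ball {G : ℂ → ℝ} (hG : IntegrableOn G (Metric.ball 0 1)) :
    Tendsto (fun r => ∫ z in Metric.ball (0 : ℂ) r, G z) (𝓝[<] (1 : ℝ))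
      (𝓝 (∫ z in Metric.ball (0 : ℂ) 1, G z)) := by
  have h : Tendsto (fun r => ∫ z in Metric.ball (0 : ℂ) 1, (Metric.ball (0 : ℂ) r).indicator G z)
      (𝓝[<] (1 : ℝ)) (𝓝 (∫ z in Metric.ball (0 : ℂ) 1, G z)) := by
    refine tendsto_integral_filter_of_dominated_convergence (fun z => ‖G z‖)
      (Eventually.of_forall fun r => hG.aestronglyMeasurable.indicator measurableSet_ball)
      (Eventually.of_forall fun r => Eventually.of_forall fun z => norm_indicator_le_norm_self _ _)
      hG.norm ?_
    refine (ae_restrict_iff' measurableSet_ball).2 (Eventually.of_forall fun z hz => ?_)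
    have hz1 : ‖z‖ < 1 := by simpa using hz
    refine tendsto_const_nhds.congr' ?_
    filter_upwards [Ioo_mem_nhdsLT hz1] with r hr
    rw [Set.indicator_of_mem (by simpa using hr.1)]
  refine h.congr' ?_
  filter_upwards [self_mem_nhdsWithin] with r hr
  rw [setIntegral_indicator measurableSet_ball,
    Set.inter_eq_right.2 (Metric.ball_subset_ball (le_of_lt hr))]

theorem tendsto_truncated_succ (μ : Measure (Metric.sphere (0 : ℂ) 1)) [IsFiniteMeasure μ]
    {f : ℂ → ℂ} (hf : f ∈ SmoothAnalytic) (n : ℕ) :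
    Tendsto (truncated μ (n + 1) f) (𝓝[<] (1 : ℝ))
      (𝓝 (∫ w : Metric.sphere (0 : ℂ) 1, localDirichlet n (taylorCoef f) w ∂μ)) := by
  set G : ℂ → ℝ := fun z =>
    ‖iteratedDeriv (n + 1) f z‖ ^ 2 * poissonExt μ z * (1 - ‖z‖ ^ 2) ^ n with hG
  set I := ∫ w : Metric.sphere (0 : ℂ) 1, localDirichlet n (taylorCoef f) w ∂μ with hI
  have hI0 : 0 ≤ I := integral_nonneg fun w => localDirichlet_nonneg n _ _
  have hGm : Measurable G := by
    have h1 : Measurable (iteratedDeriv (n + 1) f) := by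
      rw [iteratedDeriv_succ]
      exact measurable_deriv _
    have := measurable_poissonExt μ
    fun_prop
  have hG0 : 0 ≤ᵐ[volume.restrict (Metric.ball (0 : ℂ) 1)] G := by
    refine (ae_restrict_iff' measurableSet_ball).2 (Eventually.of_forall fun z hz => ?_)
    have hz1 : ‖z‖ < 1 := by simpa using hz
    have h0 : 0 ≤ 1 - ‖z‖ ^ 2 := by nlinarith [norm_nonneg z]
    have := poissonExt_nonneg μ hz1.le
    simp only [hG, Pi.zero_apply]
    positivity
  have hl := lintegral_dirichlet μ hf n
  have hGi : IntegrableOn G (Metric.ball 0 1) := by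
    refine ⟨hGm.aestronglyMeasurable, ?_⟩
    rw [hasFiniteIntegral_iff_ofReal hG0, hl]
    exact ENNReal.ofReal_lt_top
  have hint : ∫ z in Metric.ball (0 : ℂ) 1, G z = (n + 1).factorial * n.factorial * Real.pi * I := by
    rw [integral_eq_lintegral_of_nonneg_ae hG0 hGm.aestronglyMeasurable, hl,
      ENNReal.toReal_ofReal (by have := Real.pi_pos; positivity)]
  have h := (tendsto_setIntegral_ball hGi).const_mul
    (1 / ((n + 1).factorial * n.factorial * Real.pi))
  rw [hint, show 1 / ((n + 1).factorial * n.factorial * Real.pi) *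
    ((n + 1).factorial * n.factorial * Real.pi * I) = I by
      have := Real.pi_pos
      field_simp] at h
  exact h

/-! ### Abel means and the limit for order zero -/

/-- Abel's limit theorem for the series with partial sums `u`: its terms `d` satisfy `∑ d_m x^m = (1
- x) ∑ u_m x^m`. -/
theorem tendsto_abel_means {u : ℕ → ℝ} {B L : ℝ} (hB : ∀ m, |u m| ≤ B)
    (hu : Tendsto u atTop (𝓝 L)) :
    Tendsto (fun x => (1 - x) * ∑' m, u m * x ^ m) (𝓝[<] (1 : ℝ)) (𝓝 L) := by
  set d : ℕ → ℝ := fun m => Nat.casesOn m (u 0) (fun m => u (m + 1) - u m) with hd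
  have hsum : ∀ M, ∑ m ∈ Finset.range (M + 1), d m = u M := by
    intro M
    induction M with
    | zero => simp [hd]
    | succ M ih => rw [Finset.sum_range_succ, ih]; simp [hd]
  have h := Real.tendsto_tsum_powerSeries_nhdsWithin_lt (f := d) (l := L) (by
    rw [← tendsto_add_atTop_iff_nat 1]
    simpa only [hsum] using hu)
  refine h.congr' ?_
  filter_upwards [Ioo_mem_nhdsLT zero_lt_one] with x hx
  have hg : Summable fun m => B * x ^ m := (summable_geometric_of_lt_one hx.1.le hx.2).mul_left B
  have hs : Summable fun m => u m * x ^ m := by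
    refine Summable.of_norm_bounded hg fun m => ?_
    rw [norm_mul, norm_pow, Real.norm_of_nonneg hx.1.le]
    exact mul_le_mul_of_nonneg_right (hB m) (pow_nonneg hx.1.le m)
  have hs1 : Summable fun m => u (m + 1) * x ^ (m + 1) :=
    (summable_nat_add_iff (f := fun m => u m * x ^ m) 1).2 hs
  have hds : HasSum (fun m => d (m + 1) * x ^ (m + 1))
      ((∑' m, u (m + 1) * x ^ (m + 1)) - x * ∑' m, u m * x ^ m) := by
    refine (hs1.hasSum.sub (hs.hasSum.mul_left x)).congr_fun fun m => ?_
    simp only [hd]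
    ring
  have hds' : Summable fun m => d m * x ^ m := (summable_nat_add_iff 1).1 hds.summable
  rw [hds'.tsum_eq_zero_add, hds.tsum_eq, sub_mul, one_mul]
  conv_rhs => rw [hs.tsum_eq_zero_add]
  rw [hs.tsum_eq_zero_add, show d 0 = u 0 from rfl]
  ring

theorem circleAverage_mul_poisson {a : ℕ → ℂ} {f : ℂ → ℂ} (hm : Measurable f)
    (hf : ∀ z ∈ Metric.ball (0 : ℂ) 1, HasSum (fun k => a k * z ^ k) (f z)) {w : ℂ} (hw : ‖w‖ = 1)
    {r : ℝ} (hr0 : 0 ≤ r) (hr : r < 1) :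
    Real.circleAverage (fun z => ‖f z‖ ^ 2 * ((1 - ‖z‖ ^ 2) / ‖w - z‖ ^ 2)) 0 r
      = (1 - r ^ 2) * ∑' m, ‖∑ k ∈ Finset.range (m + 1), w ^ k * a k‖ ^ 2 * (r ^ 2) ^ m := by
  have h := hasSum_norm_sq_circleAverage_radius (f := fun z => f z * (w - z)⁻¹) (by fun_prop)
    (hasSum_mul_inv_sub hw hf) hr0 hr
  have h1 : Real.circleAverage (fun z => ‖f z‖ ^ 2 * ((1 - ‖z‖ ^ 2) / ‖w - z‖ ^ 2)) 0 r
      = Real.circleAverage (fun z => (1 - r ^ 2) • ‖f z * (w - z)⁻¹‖ ^ 2) 0 r := by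
    apply Real.circleAverage_congr_sphere
    intro z hz
    have hzr : ‖z‖ = r := by simpa [abs_of_nonneg hr0] using hz
    simp only [hzr, norm_mul, norm_inv, smul_eq_mul, div_eq_mul_inv]
    ring
  rw [h1, Real.circleAverage_fun_smul, ← h.tsum_eq, smul_eq_mul]
  congr 2
  ext1 m
  simp [hw, pow_mul]

theorem integral_circleAverage_swap (μ : Measure (Metric.sphere (0 : ℂ) 1)) [IsFiniteMeasure μ]
    {f : ℂ → ℂ} (hm : Measurable f) {C : ℝ} (hC : ∀ z ∈ Metric.ball (0 : ℂ) 1, ‖f z‖ ≤ C)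
    {r : ℝ} (hr0 : 0 ≤ r) (hr : r < 1) :
    Real.circleAverage (fun z => ‖f z‖ ^ 2 * poissonExt μ z) 0 r
      = ∫ w : Metric.sphere (0 : ℂ) 1,
        Real.circleAverage (fun z => ‖f z‖ ^ 2 * ((1 - ‖z‖ ^ 2) / ‖(w : ℂ) - z‖ ^ 2)) 0 r ∂μ := by
  simp only [Real.circleAverage_def, poissonExt,
    intervalIntegral.integral_of_le Real.two_pi_pos.le, smul_eq_mul]
  rw [integral_const_mul]
  congr 1
  simp only [← integral_const_mul]
  refine integral_integral_swap ?_
  refine Integrable.of_bound (C := C ^ 2 * (1 / (1 - r) ^ 2)) ?_ (Eventually.of_forall fun p => ?_)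
  · apply Measurable.aestronglyMeasurable
    simp only [Function.uncurry_def]
    have : Measurable fun p : ℝ × Metric.sphere (0 : ℂ) 1 => circleMap 0 r p.1 := by fun_prop
    fun_prop
  · have hn : ‖circleMap 0 r p.1‖ = r := by simp [abs_of_nonneg hr0]
    have h1 : 0 ≤ 1 - r ^ 2 := by nlinarith
    have h2 := one_sub_norm_le_norm_sub p.2 (circleMap 0 r p.1)
    rw [hn] at h2
    have h3 : 0 < 1 - r := by linarith
    have h4 := hC (circleMap 0 r p.1) (by rw [mem_ball_zero_iff, hn]; exact hr)
    simp only [Function.uncurry_def, hn]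
    rw [Real.norm_of_nonneg (by positivity)]
    gcongr
    nlinarith

theorem tendsto_truncated_zero (μ : Measure (Metric.sphere (0 : ℂ) 1)) [IsFiniteMeasure μ]
    {f : ℂ → ℂ} (hf : f ∈ SmoothAnalytic) :
    Tendsto (truncated μ 0 f) (𝓝[<] (1 : ℝ))
      (𝓝 (∫ w : Metric.sphere (0 : ℂ) 1, ‖f w‖ ^ 2 ∂μ)) := by
  set a := taylorCoef f
  have ha : Summable fun k => ‖a k‖ := (SmoothAnalytic.rapidDecay hf).summable
  set A := ∑' k, ‖a k‖
  -- Cutting off makes the function measurable on the whole plane, where `f` need not be.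
  set g : ℂ → ℂ := (Metric.ball (0 : ℂ) 1).indicator f with hgdef
  have hgf : ∀ z ∈ Metric.ball (0 : ℂ) 1, g z = f z := fun z hz => Set.indicator_of_mem hz f
  have hgm : Measurable g := by
    classical
    rw [hgdef, ← Set.piecewise_eq_indicator]
    exact hf.1.continuousOn.measurable_piecewise continuousOn_const measurableSet_ball
  have hg : ∀ z ∈ Metric.ball (0 : ℂ) 1, HasSum (fun k => a k * z ^ k) (g z) := by
    intro z hz
    rw [hgf z hz]
    exact hasSum_taylorCoef hf.1 hz
  obtain ⟨C, hC⟩ := (isCompact_closedBall (0 : ℂ) 1).exists_bound_of_continuousOn hf.2.continuousOn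
  set S : Metric.sphere (0 : ℂ) 1 → ℕ → ℝ :=
    fun w m => ‖∑ k ∈ Finset.range (m + 1), (w : ℂ) ^ k * a k‖ ^ 2 with hS
  have hSA : ∀ w m, |S w m| ≤ A ^ 2 := by
    intro w m
    rw [abs_of_nonneg (by positivity)]
    refine pow_le_pow_left₀ (norm_nonneg _) ?_ 2
    refine (norm_sum_le _ _).trans ?_
    refine (Finset.sum_le_sum fun k _ => ?_).trans (ha.sum_le_tsum _ fun j _ => norm_nonneg _)
    simp
  have hSlim : ∀ w : Metric.sphere (0 : ℂ) 1, Tendsto (S w) atTop (𝓝 (‖f w‖ ^ 2)) := by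
    intro w
    have h := SmoothAnalytic.hasSum_taylorCoef hf (Metric.sphere_subset_closedBall w.2)
    have := (h.tendsto_sum_nat.comp (tendsto_add_atTop_nat 1)).norm.pow 2
    refine this.congr fun m => ?_
    simp only [hS, Function.comp_apply, mul_comm]
    rfl
  have hsq : Tendsto (fun r : ℝ => r ^ 2) (𝓝[<] (1 : ℝ)) (𝓝[<] (1 : ℝ)) := by
    refine tendsto_nhdsWithin_iff.2 ⟨?_, ?_⟩
    · simpa using (continuous_pow 2 : Continuous fun r : ℝ => r ^ 2).continuousWithinAt.tendsto
        (s := Set.Iio 1) (x := 1)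
    · filter_upwards [Ioo_mem_nhdsLT zero_lt_one] with r hr
      exact pow_lt_one₀ hr.1.le hr.2 two_ne_zero
  have hmain : Tendsto (fun r : ℝ => ∫ w : Metric.sphere (0 : ℂ) 1,
      (1 - r ^ 2) * ∑' m, S w m * (r ^ 2) ^ m ∂μ) (𝓝[<] (1 : ℝ))
      (𝓝 (∫ w : Metric.sphere (0 : ℂ) 1, ‖f w‖ ^ 2 ∂μ)) := by
    refine tendsto_integral_filter_of_dominated_convergence (fun _ => A ^ 2) ?_ ?_
      (integrable_const _) ?_
    · filter_upwards [Ioo_mem_nhdsLT zero_lt_one] with r hr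
      have hr2 : r ^ 2 < 1 := pow_lt_one₀ hr.1.le hr.2 two_ne_zero
      refine (continuous_const.mul (continuous_tsum (fun m => ?_)
        ((summable_geometric_of_lt_one (sq_nonneg r) hr2).mul_left (A ^ 2))
        fun m w => ?_)).aestronglyMeasurable
      · simp only [hS]
        fun_prop
      · rw [norm_mul, Real.norm_of_nonneg (pow_nonneg (sq_nonneg r) m)]
        exact mul_le_mul_of_nonneg_right (hSA w m) (by positivity)
    · filter_upwards [Ioo_mem_nhdsLT zero_lt_one] with r hr
      refine Eventually.of_forall fun w => ?_
      have hr2 : r ^ 2 < 1 := pow_lt_one₀ hr.1.le hr.2 two_ne_zero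
      have h1 : 0 < 1 - r ^ 2 := by linarith
      have hgs := (hasSum_geometric_of_lt_one (sq_nonneg r) hr2).mul_left (A ^ 2)
      have hb : ‖∑' m, S w m * (r ^ 2) ^ m‖ ≤ A ^ 2 * (1 - r ^ 2)⁻¹ := by
        refine tsum_of_norm_bounded hgs fun m => ?_
        rw [norm_mul, Real.norm_of_nonneg (pow_nonneg (sq_nonneg r) m)]
        exact mul_le_mul_of_nonneg_right (hSA w m) (by positivity)
      rw [norm_mul, Real.norm_of_nonneg h1.le]
      calc _ ≤ (1 - r ^ 2) * (A ^ 2 * (1 - r ^ 2)⁻¹) := by gcongr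
        _ = A ^ 2 := by field_simp
    · exact Eventually.of_forall fun w => (tendsto_abel_means (hSA w) (hSlim w)).comp hsq
  refine hmain.congr' ?_
  filter_upwards [Ioo_mem_nhdsLT zero_lt_one] with r hr
  have h1 : truncated μ 0 f r = Real.circleAverage (fun z => ‖g z‖ ^ 2 * poissonExt μ z) 0 r := by
    change Real.circleAverage (fun z => ‖f z‖ ^ 2 * poissonExt μ z) 0 r = _
    apply Real.circleAverage_congr_sphere
    intro z hz
    have hzr : ‖z‖ = r := by simpa [abs_of_pos hr.1] using hz
    simp only [hgf z (by rw [mem_ball_zero_iff, hzr]; exact hr.2)]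
  rw [h1, integral_circleAverage_swap μ hgm (C := C) (fun z hz => by
    rw [hgf z hz]; exact hC z (Metric.ball_subset_closedBall hz)) hr.1.le hr.2]
  congr 1
  ext1 w
  rw [circleAverage_mul_poisson hgm hg (by simp) hr.1.le hr.2]

/-! ### Multiplication by `z` on local Dirichlet integrals -/

theorem localDirichlet_mulZ {f : ℂ → ℂ} (hf : f ∈ SmoothAnalytic) (n : ℕ) {w : ℂ} (hw : ‖w‖ = 1) :
    localDirichlet n (taylorCoef (mulZ f)) w = ‖tail (taylorCoef f) n w‖ ^ 2
      + ∑' k : ℕ, ((k + n + 1).choose n : ℝ) * ‖tail (taylorCoef f) (k + n + 1) w‖ ^ 2 := by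
  have h : ∀ k, tail (taylorCoef (mulZ f)) (k + 1) w = tail (taylorCoef f) k w := by
    intro k
    simp only [tail, show ∀ j, k + 1 + j = k + j + 1 from fun j => by ring,
      SmoothAnalytic.taylorCoef_mulZ hf]
  have hs := (SmoothAnalytic.rapidDecay hf).summable_choose_mul_norm_tail_sq n 0 hw
  simp only [add_zero] at hs
  simp only [localDirichlet, h]
  rw [Summable.tsum_eq_zero_add hs]
  simp [show ∀ k, k + 1 + n = k + n + 1 from fun k => by ring]

/-- The ratio of the two binomials is `(k+n+1)/(k+1)`, largest at `k = 0`. -/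
theorem choose_add_succ_le (k n : ℕ) :
    ((k + n + 1).choose n : ℝ) ≤ (n + 1) * ((k + n).choose n : ℝ) := by
  have h := Nat.choose_mul_succ_eq (k + n) n
  rw [show k + n + 1 - n = k + 1 by omega] at h
  have h' : ((k + n).choose n : ℝ) * (k + n + 1) = (k + n + 1).choose n * (k + 1) := by
    exact_mod_cast h
  have hk : (0 : ℝ) < k + 1 := by positivity
  refine le_of_mul_le_mul_right ?_ hk
  rw [← h']
  have : 0 ≤ ((k + n).choose n : ℝ) * (n * k) := by positivity
  nlinarith

theorem summable_choose_succ {a : ℕ → ℂ} (ha : RapidDecay a) (n : ℕ) {w : ℂ} (hw : ‖w‖ = 1) :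
    Summable fun k : ℕ => ((k + n + 1).choose n : ℝ) * ‖tail a (k + n + 1) w‖ ^ 2 := by
  refine Summable.of_nonneg_of_le (fun k => by positivity) (fun k => ?_)
    ((ha.summable_choose_mul_norm_tail_sq n 1 hw).mul_left ((n : ℝ) + 1))
  rw [← mul_assoc]
  exact mul_le_mul_of_nonneg_right (choose_add_succ_le k n) (by positivity)

theorem localDirichlet_le_mulZ {f : ℂ → ℂ} (hf : f ∈ SmoothAnalytic) (n : ℕ) {w : ℂ}
    (hw : ‖w‖ = 1) :
    localDirichlet n (taylorCoef f) w ≤ localDirichlet n (taylorCoef (mulZ f)) w := by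
  have ha := SmoothAnalytic.rapidDecay hf
  rw [localDirichlet_mulZ hf n hw]
  refine le_add_of_nonneg_of_le (by positivity) ?_
  refine Summable.tsum_le_tsum (fun k => ?_) (ha.summable_choose_mul_norm_tail_sq n 1 hw)
    (summable_choose_succ ha n hw)
  exact mul_le_mul_of_nonneg_right
    (by exact_mod_cast Nat.choose_le_choose n (Nat.le_succ _)) (by positivity)

/-- The factor `n + 3` is `n + 1` from the binomials plus `2` from squaring `t_n = a_n + w t_{n+1}`,
as `|t_{n+1}|²` is the `k = 0` term of the local integral. -/
theorem localDirichlet_mulZ_le {f : ℂ → ℂ} (hf : f ∈ SmoothAnalytic) (n : ℕ) {w : ℂ}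
    (hw : ‖w‖ = 1) :
    localDirichlet n (taylorCoef (mulZ f)) w
      ≤ 2 * ‖taylorCoef f n‖ ^ 2 + (n + 3) * localDirichlet n (taylorCoef f) w := by
  have ha := SmoothAnalytic.rapidDecay hf
  have hs := ha.summable_choose_mul_norm_tail_sq n 1 hw
  rw [localDirichlet_mulZ hf n hw]
  have h1 : ∑' k : ℕ, ((k + n + 1).choose n : ℝ) * ‖tail (taylorCoef f) (k + n + 1) w‖ ^ 2
      ≤ (n + 1) * localDirichlet n (taylorCoef f) w := by
    rw [localDirichlet, ← tsum_mul_left]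
    refine Summable.tsum_le_tsum (fun k => ?_) (summable_choose_succ ha n hw) (hs.mul_left _)
    rw [← mul_assoc]
    exact mul_le_mul_of_nonneg_right (choose_add_succ_le k n) (by positivity)
  have h2 : ‖tail (taylorCoef f) (n + 1) w‖ ^ 2 ≤ localDirichlet n (taylorCoef f) w := by
    have := hs.le_tsum 0 fun j _ => by positivity
    simpa [localDirichlet] using this
  have h3 : ‖tail (taylorCoef f) n w‖ ≤ ‖taylorCoef f n‖ + ‖tail (taylorCoef f) (n + 1) w‖ := by
    rw [tail_eq_add ha n hw]
    refine (norm_add_le _ _).trans_eq ?_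
    rw [norm_mul, hw, one_mul]
  have h4 : ‖tail (taylorCoef f) n w‖ ^ 2
      ≤ 2 * (‖taylorCoef f n‖ ^ 2 + ‖tail (taylorCoef f) (n + 1) w‖ ^ 2) :=
    (pow_le_pow_left₀ (norm_nonneg _) h3 2).trans add_sq_le
  linarith

end DirichletInt

end

/-! ### The main theorem -/

theorem proposition4p6 (μ : Measure (Metric.sphere (0 : ℂ) 1)) [IsFiniteMeasure μ] (n : ℕ) :
    -- the limits defining the Dirichlet integrals exist
    (∀ f ∈ DirichletInt.SmoothAnalytic,
      Tendsto (DirichletInt.truncated μ n f) (𝓝[<] (1 : ℝ)) (𝓝 (DirichletInt.dirichlet μ n f))) ∧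
    (∀ f ∈ DirichletInt.SmoothAnalytic,
      DirichletInt.dirichlet μ n f ≤ DirichletInt.dirichlet μ n (DirichletInt.mulZ f)) ∧
    ∃ C : ℝ, 0 < C ∧ ∀ f ∈ DirichletInt.SmoothAnalytic,
      DirichletInt.dirichlet μ n (DirichletInt.mulZ f) ≤
        C * (‖DirichletInt.fourierCoef f ((n : ℤ) - 1)‖ ^ 2 + DirichletInt.dirichlet μ n f) := by
  open DirichletInt in
  cases n with
  | zero =>
    have hD : ∀ f ∈ SmoothAnalytic,
        dirichlet μ 0 f = ∫ w : Metric.sphere (0 : ℂ) 1, ‖f w‖ ^ 2 ∂μ :=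
      fun f hf => (tendsto_truncated_zero μ hf).limUnder_eq
    have hz : ∀ f ∈ SmoothAnalytic, dirichlet μ 0 (mulZ f) = dirichlet μ 0 f := by
      intro f hf
      rw [hD f hf, hD _ (mulZ_mem hf)]
      simp [mulZ]
    refine ⟨fun f hf => ?_, fun f hf => (hz f hf).ge, 1, one_pos, fun f hf => ?_⟩
    · rw [hD f hf]
      exact tendsto_truncated_zero μ hf
    · rw [hz f hf, one_mul]
      exact le_add_of_nonneg_left (by positivity)
  | succ n =>
    have hD : ∀ f ∈ SmoothAnalytic, dirichlet μ (n + 1) f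
        = ∫ w : Metric.sphere (0 : ℂ) 1, localDirichlet n (taylorCoef f) w ∂μ :=
      fun f hf => (tendsto_truncated_succ μ hf n).limUnder_eq
    have hi : ∀ f ∈ SmoothAnalytic,
        Integrable (fun w : Metric.sphere (0 : ℂ) 1 => localDirichlet n (taylorCoef f) w) μ :=
      fun f hf => (continuous_localDirichlet (SmoothAnalytic.rapidDecay hf)
        n).integrable_of_hasCompactSupport (HasCompactSupport.of_compactSpace _)
    -- Integrating the local bound gives `2 μ(𝕋)` for the coefficient and `n + 3` for the Dirichlet
    -- integral; their sum dominates both and is positive even if `μ = 0`.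
    refine ⟨fun f hf => ?_, fun f hf => ?_, 2 * μ.real Set.univ + (n + 3), by positivity,
      fun f hf => ?_⟩
    · rw [hD f hf]
      exact tendsto_truncated_succ μ hf n
    · rw [hD f hf, hD _ (mulZ_mem hf)]
      exact integral_mono (hi f hf) (hi _ (mulZ_mem hf))
        fun w => localDirichlet_le_mulZ hf n (by simp)
    · have hc : fourierCoef f (((n + 1 : ℕ) : ℤ) - 1) = taylorCoef f n := by
        rw [← SmoothAnalytic.fourierCoef_eq hf]
        congr 1
        push_cast
        ring
      rw [hc, hD f hf, hD _ (mulZ_mem hf)]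
      have h := integral_mono (hi _ (mulZ_mem hf))
        ((integrable_const (2 * ‖taylorCoef f n‖ ^ 2)).add ((hi f hf).const_mul ((n : ℝ) + 3)))
        fun w => localDirichlet_mulZ_le hf n (by simp)
      refine h.trans ?_
      rw [integral_add' (integrable_const _) ((hi f hf).const_mul _), integral_const,
        integral_const_mul, smul_eq_mul]
      have h0 : 0 ≤ ∫ w : Metric.sphere (0 : ℂ) 1, localDirichlet n (taylorCoef f) w ∂μ :=
        integral_nonneg fun w => localDirichlet_nonneg n _ _
      have h1 : 0 ≤ μ.real Set.univ := measureReal_nonneg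
      have h2 := mul_nonneg h1 h0
      have h3 : 0 ≤ ((n : ℝ) + 3) * ‖taylorCoef f n‖ ^ 2 := by positivity
      linarith
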